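/- All graphs are finite and simple. For a graph $G$ and a real number $\alpha\in[0,1]$ let $A_\alpha(G)=\alpha D(G)+(1-\alpha)A(G)$, where $A(G)$ is the adjacency matrix and $D(G)$ the diagonal matrix of vertex degrees; the $A_\alpha$-spectrum of $G$ is the multiset of eigenvalues of $A_\alpha(G)$, i.e. the roots of $\det(xI-A_\alpha(G))$ with multiplicity. Let $G$ and $H$ be $A_\alpha$-cospectral graphs, meaning that, for every $\alpha\in[0,1]$, the $A_\alpha$-spectra of $G$ and $H$ coincide. Then: (a) $G$ and $H$ have the same number of vertices; (b) $G$ and $H$ have the same number of edges; (c) $G$ is regular if and only if $H$ is regular; (d) for every $g\in\mathbb{N}\cup\{\infty\}$, $G$ is regular with girth $g$ if and only if $H$ is regular with girth $g$ (the girth of a graph without cycles is $\infty$); (e) $G$ is bipartite if and only if $H$ is bipartite; (f) for every integer $k\ge 0$, $G$ and $H$ have the same number of closed walks of length $k$ (a closed walk being counted with its starting vertex); in particular, they have the same number of triangles; (g) $\sum_{v\in V(G)}d_G(v)^2=\sum_{w\in V(H)}d_H(w)^2$, where $d_G(v)$ is the degree of $v$ in $G$; (h) $\sum_{v\in V(G)}d_G(v)^3=\sum_{w\in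 V(H)}d_H(w)^3$. If moreover $G$ is bipartite, then: (i) $G$ and $H$ have the same number of connected components; (j) $G$ and $H$ have the same number of spanning trees. -/

import Mathlib

namespace AlphaSpectra

/-- The matrix `A_α(G) = α D(G) + (1 - α) A(G)` of a finite simple graph `G`. -/
noncomputable def alphaMatrix {V : Type*} [Fintype V] [DecidableEq V] (G : SimpleGraph V)
    [DecidableRel G.Adj] (α : ℝ) : Matrix V V ℝ :=
  α • G.degMatrix ℝ + (1 - α) • G.adjMatrix ℝ

/-- The `A_α`-spectrum of `G`: the multiset of roots, with multiplicity, of the characteristic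
polynomial of `A_α(G)`. The matrix is real symmetric, so all these roots are real. -/
noncomputable def alphaSpectrum {V : Type*} [Fintype V] [DecidableEq V] (G : SimpleGraph V)
    [DecidableRel G.Adj] (α : ℝ) : Multiset ℝ :=
  (alphaMatrix G α).charpoly.roots

/-- `G` and `H` are `A_α`-cospectral: they have the same `A_α`-spectrum, where `α` is a parameter
running over `[0, 1]`, so that the spectra agree for each value of the parameter. -/
def AlphaCospectral {V W : Type*} [Fintype V] [DecidableEq V] [Fintype W] [DecidableEq W]
    (G : SimpleGraph V) [DecidableRel G.Adj] (H : SimpleGraph W) [DecidableRel H.Adj] : Prop :=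
  ∀ α ∈ Set.Icc (0 : ℝ) 1, alphaSpectrum G α = alphaSpectrum H α

/-- `G` is regular: all its vertices have the same degree. -/
def IsRegular {V : Type*} [Fintype V] (G : SimpleGraph V) [DecidableRel G.Adj] : Prop :=
  ∃ d : ℕ, G.IsRegularOfDegree d

/-- The number of closed walks of length `k` in `G` (a closed walk comes with its base vertex). -/
noncomputable def numClosedWalks {V : Type*} (G : SimpleGraph V) (k : ℕ) : ℕ :=
  Nat.card {p : (v : V) × G.Walk v v // p.2.length = k}

/-- The number of spanning trees of `G`: trees on the whole vertex set all of whose edges are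
edges of `G`. -/
noncomputable def numSpanningTrees {V : Type*} (G : SimpleGraph V) : ℕ :=
  Nat.card {T : SimpleGraph V // T ≤ G ∧ T.IsTree}

end AlphaSpectra

/-! Only the parameters 1, 0 and 1/2 are used. Real symmetric matrices have split characteristic
polynomials, so equal spectra give equal characteristic polynomials and equal traces of every
polynomial in the matrix. At 1 the matrix is `D`, so the multiset of degrees is determined. At 0 it
is `A`, and traces of powers count closed walks; triangles and bipartiteness (no odd closed walks)
follow. In a `d`-regular graph the matrix counting non-backtracking walks of a given length is a
polynomial in `A` depending only on `d` and that length, and the girth can be read off from which of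
these matrices have nonzero trace. At 1/2 the matrix is half of `D + A`, which for a bipartite graph
is similar to the Laplacian `L = D - A`. Components are then counted by `ker L`, and spanning trees
by the linear coefficient of `det (t + L)`, which enumerates rooted spanning forests. -/

section

open Matrix Polynomial

/-! ### Spectra of real symmetric matrices -/

namespace Matrix

/-- The trace of a power of a real symmetric matrix is a power sum of the roots of its
characteristic polynomial. -/
theorem IsHermitian.trace_pow_eq_sum_roots {n : Type*} [Fintype n] [DecidableEq n]
    {A : Matrix n n ℝ} (hA : A.IsHermitian) (k : ℕ) :
    (A ^ k).trace = (A.charpoly.roots.map (· ^ k)).sum := by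
  have h : (A ^ k).trace = ((diagonal (RCLike.ofReal ∘ hA.eigenvalues) : Matrix n n ℝ) ^ k).trace := by
    conv_lhs => rw [hA.spectral_theorem, ← map_pow, Unitary.conjStarAlgAut_apply, trace_mul_comm,
      ← mul_assoc]
    simp
  rw [h, diagonal_pow, trace_diagonal, hA.roots_charpoly_eq_eigenvalues]
  simp

theorem IsHermitian.card_roots_charpoly {n : Type*} [Fintype n] [DecidableEq n]
    {A : Matrix n n ℝ} (hA : A.IsHermitian) : A.charpoly.roots.card = Fintype.card n := by
  simp [hA.roots_charpoly_eq_eigenvalues]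

theorem IsHermitian.charpoly_eq_of_roots_eq {n m : Type*} [Fintype n] [DecidableEq n]
    [Fintype m] [DecidableEq m] {A : Matrix n n ℝ} {B : Matrix m m ℝ} (hA : A.IsHermitian)
    (hB : B.IsHermitian) (h : A.charpoly.roots = B.charpoly.roots) : A.charpoly = B.charpoly := by
  rw [hA.splits_charpoly.eq_prod_roots_of_monic A.charpoly_monic,
    hB.splits_charpoly.eq_prod_roots_of_monic B.charpoly_monic, h]

theorem IsHermitian.trace_aeval_eq_of_roots_eq {n m : Type*} [Fintype n] [DecidableEq n]
    [Fintype m] [DecidableEq m] {A : Matrix n n ℝ} {B : Matrix m m ℝ} (hA : A.IsHermitian)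
    (hB : B.IsHermitian) (h : A.charpoly.roots = B.charpoly.roots) (p : ℝ[X]) :
    (aeval A p).trace = (aeval B p).trace := by
  simp only [aeval_eq_sum_range, trace_sum, trace_smul, hA.trace_pow_eq_sum_roots,
    hB.trace_pow_eq_sum_roots, h]

/-- The rank is the number of nonzero eigenvalues. This form makes the nullity visibly a function of
the characteristic polynomial. -/
theorem IsHermitian.finrank_ker_eq_sub {n : Type*} [Fintype n] [DecidableEq n]
    {A : Matrix n n ℝ} (hA : A.IsHermitian) :
    Module.finrank ℝ A.toLin'.ker =
      A.charpoly.roots.card - (A.charpoly.roots.filter (· ≠ 0)).card := by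
  have h1 : A.rank = (A.charpoly.roots.filter (· ≠ 0)).card := by
    rw [hA.rank_eq_card_non_zero_eigs, hA.roots_charpoly_eq_eigenvalues, Multiset.filter_map,
      Multiset.card_map, Fintype.card_subtype]
    simp [Finset.card_def]
  have h2 : A.rank + Module.finrank ℝ A.toLin'.ker = A.charpoly.roots.card := by
    rw [hA.card_roots_charpoly, ← Module.finrank_fintype_fun_eq_card ℝ,
      ← A.toLin'.finrank_range_add_finrank_ker]
    rfl
  omega

end Matrix

/-! ### Vertices, edges and degrees -/

namespace AlphaSpectra

variable {V W : Type*} [Fintype V] [DecidableEq V] [Fintype W] [DecidableEq W]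

theorem isHermitian_alphaMatrix (G : SimpleGraph V) [DecidableRel G.Adj] (α : ℝ) :
    (alphaMatrix G α).IsHermitian :=
  ((G.isHermitian_degMatrix ℝ).smul (IsSelfAdjoint.all α)).add
    ((G.isHermitian_adjMatrix ℝ).smul (IsSelfAdjoint.all (1 - α)))

@[simp]
theorem alphaMatrix_zero (G : SimpleGraph V) [DecidableRel G.Adj] :
    alphaMatrix G 0 = G.adjMatrix ℝ := by simp [alphaMatrix]

@[simp]
theorem alphaMatrix_one (G : SimpleGraph V) [DecidableRel G.Adj] :
    alphaMatrix G 1 = G.degMatrix ℝ := by simp [alphaMatrix]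

namespace AlphaCospectral

variable {G : SimpleGraph V} [DecidableRel G.Adj] {H : SimpleGraph W} [DecidableRel H.Adj]

theorem symm (h : AlphaCospectral G H) : AlphaCospectral H G := fun α hα => (h α hα).symm

theorem card_eq (h : AlphaCospectral G H) : Fintype.card V = Fintype.card W := by
  have h0 := congrArg Multiset.card (h 0 (by simp))
  simpa only [alphaSpectrum, (isHermitian_alphaMatrix _ _).card_roots_charpoly] using h0

theorem trace_aeval_adjMatrix_eq (h : AlphaCospectral G H) (p : ℝ[X]) :
    (aeval (G.adjMatrix ℝ) p).trace = (aeval (H.adjMatrix ℝ) p).trace := by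
  have h0 := h 0 (by simp)
  simp only [alphaSpectrum, alphaMatrix_zero] at h0
  exact (G.isHermitian_adjMatrix ℝ).trace_aeval_eq_of_roots_eq (H.isHermitian_adjMatrix ℝ) h0 p

theorem trace_adjMatrix_pow_eq (h : AlphaCospectral G H) (k : ℕ) :
    (G.adjMatrix ℝ ^ k).trace = (H.adjMatrix ℝ ^ k).trace := by
  simpa using h.trace_aeval_adjMatrix_eq (X ^ k)

/-- The degrees are the eigenvalues of `A_1`, so cospectral graphs have the same degrees. -/
theorem map_degree_eq (h : AlphaCospectral G H) :
    (Finset.univ.val.map fun v => G.degree v) = Finset.univ.val.map fun w => H.degree w := by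
  have h1 := h 1 (by simp)
  simp only [alphaSpectrum, alphaMatrix_one, SimpleGraph.degMatrix, charpoly_diagonal] at h1
  rw [Polynomial.roots_prod _ _ (Finset.prod_ne_zero_iff.2 fun _ _ => X_sub_C_ne_zero _),
    Polynomial.roots_prod _ _ (Finset.prod_ne_zero_iff.2 fun _ _ => X_sub_C_ne_zero _)] at h1
  apply Multiset.map_injective (Nat.cast_injective (R := ℝ))
  simpa only [roots_X_sub_C, Multiset.bind_singleton, Multiset.map_map, Function.comp_def] using h1

theorem sum_degree_eq (h : AlphaCospectral G H) (f : ℕ → ℕ) :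
    ∑ v, f (G.degree v) = ∑ w, f (H.degree w) := by
  simpa using congrArg (fun s => (s.map f).sum) h.map_degree_eq

theorem card_edgeFinset_eq (h : AlphaCospectral G H) :
    G.edgeFinset.card = H.edgeFinset.card := by
  have h1 := h.sum_degree_eq id
  simp only [id, SimpleGraph.sum_degrees_eq_twice_card_edges] at h1
  omega

theorem isRegularOfDegree (h : AlphaCospectral G H) {d : ℕ} (hG : G.IsRegularOfDegree d) :
    H.IsRegularOfDegree d := by
  intro w
  have hw : H.degree w ∈ Finset.univ.val.map fun w => H.degree w :=
    Multiset.mem_map_of_mem _ (Finset.mem_univ w)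
  rw [← h.map_degree_eq, Multiset.mem_map] at hw
  obtain ⟨v, -, hv⟩ := hw
  rw [← hv, hG v]

theorem isRegular_iff (h : AlphaCospectral G H) : IsRegular G ↔ IsRegular H :=
  ⟨fun ⟨d, hd⟩ => ⟨d, h.isRegularOfDegree hd⟩, fun ⟨d, hd⟩ => ⟨d, h.symm.isRegularOfDegree hd⟩⟩

end AlphaCospectral

end AlphaSpectra

/-! ### Closed walks, triangles and bipartiteness -/

namespace AlphaSpectra

variable {V W : Type*} [Fintype V] [DecidableEq V] [Fintype W] [DecidableEq W]

theorem natCast_numClosedWalks (G : SimpleGraph V) [DecidableRel G.Adj] (k : ℕ) :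
    (numClosedWalks G k : ℝ) = (G.adjMatrix ℝ ^ k).trace := by
  have e : {p : (v : V) × G.Walk v v // p.2.length = k} ≃
      (v : V) × {p : G.Walk v v // p.length = k} :=
    { toFun := fun p => ⟨p.1.1, p.1.2, p.2⟩
      invFun := fun p => ⟨⟨p.1, p.2.1⟩, p.2.2⟩
      left_inv := fun _ => rfl
      right_inv := fun _ => rfl }
  rw [numClosedWalks, Nat.card_congr e, trace]
  have : ∀ v, Fintype {p : G.Walk v v // p.length = k} := fun v =>
    inferInstanceAs (Fintype {p : G.Walk v v | p.length = k})
  simp only [diag_apply, SimpleGraph.adjMatrix_pow_apply_eq_card_walk]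
  rw [Nat.card_eq_fintype_card, Fintype.card_sigma]
  push_cast
  refine Finset.sum_congr rfl fun v _ => ?_
  congr 1
  exact Fintype.card_congr (Equiv.refl _)

/-- Every triangle has six orderings of its vertices. -/
theorem trace_adjMatrix_pow_three (G : SimpleGraph V) [DecidableRel G.Adj] :
    (G.adjMatrix ℝ ^ 3).trace = 6 * (G.cliqueFinset 3).card := by
  -- The ordered triangles; forgetting the order is a six-to-one map onto the 3-cliques.
  let S : Finset (V × V × V) := {x | G.Adj x.1 x.2.1 ∧ G.Adj x.2.1 x.2.2 ∧ G.Adj x.2.2 x.1}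
  have h1 : (G.adjMatrix ℝ ^ 3).trace = S.card := by
    simp only [S, ← Finset.sum_boole, Fintype.sum_prod_type]
    simp only [trace, diag_apply, pow_succ, pow_zero, one_mul, mul_apply,
      SimpleGraph.adjMatrix_apply, Finset.sum_mul]
    refine Finset.sum_congr rfl fun u _ => ?_
    rw [Finset.sum_comm]
    refine Finset.sum_congr rfl fun v _ => Finset.sum_congr rfl fun w _ => ?_
    split_ifs <;> simp_all
  have h2 : S.card = (G.cliqueFinset 3).card * 6 := by
    rw [Finset.card_eq_sum_card_fiberwise (f := fun x => {x.1, x.2.1, x.2.2})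
      (t := G.cliqueFinset 3), Finset.sum_const_nat (m := 6)]
    · intro t ht
      obtain ⟨a, b, c, hab, hac, hbc, rfl⟩ :=
        SimpleGraph.is3Clique_iff.1 (SimpleGraph.mem_cliqueFinset_iff.1 ht)
      have h : S.filter (fun x => ({x.1, x.2.1, x.2.2} : Finset V) = {a, b, c}) =
          {(a, b, c), (a, c, b), (b, a, c), (b, c, a), (c, a, b), (c, b, a)} := by
        ext ⟨x, y, z⟩
        simp only [S, Finset.mem_filter, Finset.mem_univ, true_and, Finset.mem_insert,
          Finset.mem_singleton, Prod.mk.injEq]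
        constructor
        · rintro ⟨⟨hxy, hyz, hzx⟩, h⟩
          have hx : x ∈ ({a, b, c} : Finset V) := h ▸ by simp
          have hy : y ∈ ({a, b, c} : Finset V) := h ▸ by simp
          have hz : z ∈ ({a, b, c} : Finset V) := h ▸ by simp
          have := hxy.ne
          have := hyz.ne
          have := hzx.ne
          simp only [Finset.mem_insert, Finset.mem_singleton] at hx hy hz
          grind
        · have := hab.symm
          have := hac.symm
          have := hbc.symm
          rintro (⟨rfl, rfl, rfl⟩ | ⟨rfl, rfl, rfl⟩ | ⟨rfl, rfl, rfl⟩ | ⟨rfl, rfl, rfl⟩ |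
            ⟨rfl, rfl, rfl⟩ | ⟨rfl, rfl, rfl⟩) <;> refine ⟨⟨?_, ?_, ?_⟩, ?_⟩ <;>
            first | assumption | rfl | (ext; simp only [Finset.mem_insert, Finset.mem_singleton]; tauto)
      rw [h]
      have := hab.ne
      have := hac.ne
      have := hbc.ne
      rw [Finset.card_insert_of_notMem, Finset.card_insert_of_notMem,
        Finset.card_insert_of_notMem, Finset.card_insert_of_notMem,
        Finset.card_insert_of_notMem, Finset.card_singleton] <;> grind
    · intro x hx
      simp only [S, Finset.coe_filter, Finset.mem_univ, true_and, Set.mem_ofPred_eq] at hx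
      exact SimpleGraph.mem_cliqueFinset_iff.2
        (SimpleGraph.is3Clique_triple_iff.2 ⟨hx.1, hx.2.2.symm, hx.2.1⟩)
  rw [h1, h2]
  push_cast
  ring

theorem isBipartite_iff_numClosedWalks (G : SimpleGraph V) :
    G.IsBipartite ↔ ∀ k, Odd k → numClosedWalks G k = 0 := by
  classical
  -- `Nat.card` is also 0 on infinite types, so finiteness is needed to read 0 as "no such walk".
  have hfin : ∀ k, Finite {p : (v : V) × G.Walk v v // p.2.length = k} := fun k => by
    let f : {p : (v : V) × G.Walk v v // p.2.length = k} →
      (v : V) × {p : G.Walk v v // p.length = k} := fun p => ⟨p.1.1, p.1.2, p.2⟩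
    have : ∀ v, Finite {p : G.Walk v v // p.length = k} := fun v =>
      inferInstanceAs (Finite {p : G.Walk v v | p.length = k})
    refine Finite.of_injective f ?_
    rintro ⟨⟨v, p⟩, hp⟩ ⟨⟨w, q⟩, hq⟩ h
    simp only [f, Sigma.mk.injEq] at h
    obtain ⟨rfl, h⟩ := h
    simpa using h
  rw [SimpleGraph.IsBipartite, SimpleGraph.two_colorable_iff_forall_loop_even]
  constructor
  · intro h k hk
    have : IsEmpty {p : (v : V) × G.Walk v v // p.2.length = k} :=
      ⟨fun p => Nat.not_even_iff_odd.2 hk (p.2 ▸ h _ p.1.2)⟩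
    exact Nat.card_of_isEmpty
  · intro h u w
    by_contra hw
    have := hfin w.length
    have h0 := h w.length (Nat.not_even_iff_odd.1 hw)
    rw [numClosedWalks, Finite.card_eq_zero_iff] at h0
    exact h0.false ⟨⟨u, w⟩, rfl⟩

namespace AlphaCospectral

variable {G : SimpleGraph V} [DecidableRel G.Adj] {H : SimpleGraph W} [DecidableRel H.Adj]

theorem numClosedWalks_eq (h : AlphaCospectral G H) (k : ℕ) :
    numClosedWalks G k = numClosedWalks H k := by
  have := h.trace_adjMatrix_pow_eq k
  rw [← natCast_numClosedWalks, ← natCast_numClosedWalks] at this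
  exact_mod_cast this

theorem card_cliqueFinset_three_eq (h : AlphaCospectral G H) :
    (G.cliqueFinset 3).card = (H.cliqueFinset 3).card := by
  have := h.trace_adjMatrix_pow_eq 3
  rw [trace_adjMatrix_pow_three, trace_adjMatrix_pow_three] at this
  have h6 : 6 * (G.cliqueFinset 3).card = 6 * (H.cliqueFinset 3).card := by exact_mod_cast this
  omega

theorem isBipartite_iff (h : AlphaCospectral G H) : G.IsBipartite ↔ H.IsBipartite := by
  simp only [isBipartite_iff_numClosedWalks, h.numClosedWalks_eq]

end AlphaCospectral

end AlphaSpectra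

/-! ### Non-backtracking walks and girth -/

namespace SimpleGraph

variable {V : Type*} [Fintype V] [DecidableEq V] (G : SimpleGraph V) [DecidableRel G.Adj]

/-- The number of non-backtracking walks that start with the arc from `u` to `v`, then make `k`
more steps, and end in `w`. -/
def nonbacktracking : ℕ → V → V → V → ℕ
  | 0, u, v, w => if G.Adj u v ∧ v = w then 1 else 0
  | k + 1, u, v, w => if G.Adj u v then ∑ x with x ≠ u, nonbacktracking k v x w else 0

/-- The matrix counting the non-backtracking walks of length `k + 1`. -/
def nonbacktrackingMatrix (k : ℕ) : Matrix V V ℝ :=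
  of fun u w => ∑ v, (G.nonbacktracking k u v w : ℝ)

variable {G}

theorem nonbacktracking_of_not_adj {k : ℕ} {u v w : V} (h : ¬ G.Adj u v) :
    G.nonbacktracking k u v w = 0 := by
  cases k <;> simp [nonbacktracking, h]

theorem natCast_nonbacktracking_succ {k : ℕ} {u v w : V} (h : G.Adj u v) :
    (G.nonbacktracking (k + 1) u v w : ℝ) =
      G.nonbacktrackingMatrix k v w - G.nonbacktracking k v u w := by
  rw [nonbacktracking, if_pos h, nonbacktrackingMatrix, of_apply,
    ← Finset.add_sum_erase _ _ (Finset.mem_univ u), add_sub_cancel_left]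
  push_cast
  refine Finset.sum_congr ?_ fun _ _ => rfl
  ext x
  simp

theorem nonbacktrackingMatrix_zero : G.nonbacktrackingMatrix 0 = G.adjMatrix ℝ := by
  ext u w
  simp only [nonbacktrackingMatrix, of_apply, nonbacktracking, adjMatrix_apply]
  rw [Finset.sum_eq_single w] <;> simp +contextual

theorem nonbacktrackingMatrix_succ (k : ℕ) (u w : V) :
    G.nonbacktrackingMatrix (k + 1) u w =
      (G.adjMatrix ℝ * G.nonbacktrackingMatrix k) u w -
        ∑ v ∈ G.neighborFinset u, (G.nonbacktracking k v u w : ℝ) := by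
  rw [adjMatrix_mul_apply, ← Finset.sum_sub_distrib, nonbacktrackingMatrix, of_apply]
  have h : G.neighborFinset u ⊆ Finset.univ := Finset.subset_univ _
  rw [← Finset.sum_subset h]
  · exact Finset.sum_congr rfl fun v hv =>
      natCast_nonbacktracking_succ ((G.mem_neighborFinset u v).1 hv)
  · intro v _ hv
    rw [nonbacktracking_of_not_adj (by simpa using hv), Nat.cast_zero]

/-- The walks to discard are `u, v, u`, one for each of the `d` neighbours. The general recursion
subtracts with factor `d - 1`, so this case stands apart. -/
theorem IsRegularOfDegree.nonbacktrackingMatrix_one {d : ℕ} (hG : G.IsRegularOfDegree d) :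
    G.nonbacktrackingMatrix 1 = G.adjMatrix ℝ * G.adjMatrix ℝ - (d : ℝ) • 1 := by
  ext u w
  rw [nonbacktrackingMatrix_succ, nonbacktrackingMatrix_zero, Matrix.sub_apply]
  congr 1
  have h (v : V) (hv : v ∈ G.neighborFinset u) :
      (G.nonbacktracking 0 v u w : ℝ) = if u = w then 1 else 0 := by
    simp [nonbacktracking, ((G.mem_neighborFinset u v).1 hv).symm]
  rw [Finset.sum_congr rfl h]
  by_cases h : u = w <;> simp [h, one_apply, hG.degree_eq]

/-- A discarded walk goes from `u` to `v` and back, then continues from `u` by a non-backtracking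
walk not starting towards `v`. Each continuation thus arises from every neighbour `v` but one, hence
`d - 1` times. -/
theorem IsRegularOfDegree.nonbacktrackingMatrix_add_two {d : ℕ} (hG : G.IsRegularOfDegree d)
    (k : ℕ) : G.nonbacktrackingMatrix (k + 2) =
      G.adjMatrix ℝ * G.nonbacktrackingMatrix (k + 1) -
        ((d : ℝ) - 1) • G.nonbacktrackingMatrix k := by
  ext u w
  rw [nonbacktrackingMatrix_succ, Matrix.sub_apply, Matrix.smul_apply, smul_eq_mul]
  congr 1
  rw [Finset.sum_congr rfl fun v hv =>
    natCast_nonbacktracking_succ ((G.mem_neighborFinset u v).1 hv).symm]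
  rw [Finset.sum_sub_distrib, Finset.sum_const, card_neighborFinset_eq_degree, hG.degree_eq,
    sub_mul, one_mul, nsmul_eq_mul]
  congr 1
  rw [nonbacktrackingMatrix, of_apply]
  refine Finset.sum_subset (Finset.subset_univ _) fun v _ hv => ?_
  rw [nonbacktracking_of_not_adj (by simpa using hv), Nat.cast_zero]

/-- The polynomials that express the numbers of non-backtracking walks of a `d`-regular graph
in terms of its adjacency matrix. -/
noncomputable def nonbacktrackingPoly (d : ℕ) : ℕ → ℝ[X]
  | 0 => X
  | 1 => X * X - (d : ℝ) • 1
  | k + 2 => X * nonbacktrackingPoly d (k + 1) - ((d : ℝ) - 1) • nonbacktrackingPoly d k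

theorem IsRegularOfDegree.aeval_nonbacktrackingPoly {d : ℕ} (hG : G.IsRegularOfDegree d) (k : ℕ) :
    aeval (G.adjMatrix ℝ) (nonbacktrackingPoly d k) = G.nonbacktrackingMatrix k := by
  induction k using nonbacktrackingPoly.induct with
  | case1 => simp [nonbacktrackingPoly, nonbacktrackingMatrix_zero]
  | case2 => rw [hG.nonbacktrackingMatrix_one]; simp [nonbacktrackingPoly, -map_smul, map_smul (aeval _)]
  | case3 k ih1 ih2 =>
    rw [nonbacktrackingPoly, hG.nonbacktrackingMatrix_add_two, map_sub, map_mul, map_smul, ih1, ih2,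
      aeval_X]

/-- Build the walk from its end backwards: it stays a path until a new first vertex is already on
it, which closes a cycle. -/
theorem exists_isPath_or_isCycle_of_nonbacktracking_ne_zero {k : ℕ} {u v w : V}
    (h : G.nonbacktracking k u v w ≠ 0) :
    (∃ (a : V) (c : G.Walk a a), c.IsCycle ∧ c.length ≤ k + 1) ∨
      ∃ (huv : G.Adj u v) (p : G.Walk v w), (Walk.cons huv p).IsPath ∧ p.length = k := by
  induction k generalizing u v with
  | zero =>
    simp only [nonbacktracking, ne_eq, ite_eq_right_iff, Classical.not_imp] at h
    obtain ⟨⟨huv, rfl⟩, -⟩ := h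
    exact Or.inr ⟨huv, Walk.nil, by simp [huv.ne], rfl⟩
  | succ k ih =>
    simp only [nonbacktracking, ne_eq, ite_eq_right_iff, Classical.not_imp,
      Finset.sum_eq_zero_iff, not_forall, Finset.mem_filter, Finset.mem_univ, true_and] at h
    obtain ⟨huv, x, hxu, hx⟩ := h
    obtain ⟨a, c, hc, hlen⟩ | ⟨hvx, p, hp, hlen⟩ := ih hx
    · exact Or.inl ⟨a, c, hc, by omega⟩
    by_cases hu : u ∈ p.support
    -- Not backtracking, `x ≠ u`, is what keeps this closed walk from traversing the edge `uv`
    -- twice.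
    · refine Or.inl ⟨u, Walk.cons huv (Walk.cons hvx (p.takeUntil u hu)), ?_, ?_⟩
      · rw [Walk.cons_isPath_iff] at hp
        have hv : v ∉ (p.takeUntil u hu).support := fun h => hp.2 (p.support_takeUntil_subset_support hu h)
        rw [Walk.cons_isCycle_iff, Walk.cons_isPath_iff]
        refine ⟨⟨hp.1.takeUntil hu, hv⟩, ?_⟩
        rw [Walk.edges_cons, List.mem_cons, not_or]
        refine ⟨?_, fun h => hv (Walk.snd_mem_support_of_mem_edges _ h)⟩
        have := huv.ne
        grind
      · have := p.length_takeUntil_le_length hu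
        simp only [Walk.length_cons]
        omega
    · refine Or.inr ⟨huv, Walk.cons hvx p, ?_, by simp [hlen]⟩
      rw [Walk.cons_isPath_iff huv]
      exact ⟨hp, by simp [hu, huv.ne]⟩

/-- A path never turns back, so only the first turn needs `he`. The vertex `u` may lie on `p`, which
is the case needed for a cycle. -/
theorem nonbacktracking_ne_zero_of_isPath {u v w : V} (huv : G.Adj u v) (p : G.Walk v w)
    (hp : p.IsPath) (he : s(u, v) ∉ p.edges) : G.nonbacktracking p.length u v w ≠ 0 := by
  induction p generalizing u with
  | nil => simp [nonbacktracking, huv]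
  | @cons v x w hvx p ih =>
    rw [Walk.cons_isPath_iff] at hp
    have hx := ih hvx hp.1 fun h => hp.2 (Walk.fst_mem_support_of_mem_edges _ h)
    rw [Walk.length_cons, nonbacktracking, if_pos huv]
    simp only [ne_eq, Finset.sum_eq_zero_iff, not_forall]
    refine ⟨x, ?_, hx⟩
    rw [Finset.mem_filter]
    refine ⟨Finset.mem_univ _, ?_⟩
    rintro rfl
    exact he (by simp [Sym2.eq_swap])

theorem exists_trace_nonbacktrackingMatrix_ne_zero_of_isCycle {u : V} {c : G.Walk u u}
    (hc : c.IsCycle) : ∃ k, k + 1 = c.length ∧ (G.nonbacktrackingMatrix k).trace ≠ 0 := by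
  cases c with
  | nil => simp at hc
  | @cons _ v _ huv p =>
    rw [Walk.cons_isCycle_iff] at hc
    refine ⟨p.length, rfl, ?_⟩
    have h := nonbacktracking_ne_zero_of_isPath huv p hc.1 hc.2
    simp only [trace, diag_apply, nonbacktrackingMatrix, of_apply]
    norm_cast
    intro h0
    rw [Finset.sum_eq_zero_iff] at h0
    exact h (Finset.sum_eq_zero_iff.1 (h0 u (Finset.mem_univ _)) v (Finset.mem_univ _))

theorem exists_isCycle_of_trace_nonbacktrackingMatrix_ne_zero {k : ℕ}
    (h : (G.nonbacktrackingMatrix k).trace ≠ 0) :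
    ∃ (a : V) (c : G.Walk a a), c.IsCycle ∧ c.length ≤ k + 1 := by
  obtain ⟨u, -, hu⟩ := Finset.exists_ne_zero_of_sum_ne_zero h
  obtain ⟨v, -, hv⟩ := Finset.exists_ne_zero_of_sum_ne_zero hu
  obtain hc | ⟨huv, p, hp, -⟩ :=
    exists_isPath_or_isCycle_of_nonbacktracking_ne_zero (Nat.cast_ne_zero.1 hv)
  · exact hc
  · rw [Walk.cons_isPath_iff] at hp
    exact absurd p.end_mem_support hp.2

/-- The girth is the least length of a closed non-backtracking walk. -/
theorem egirth_eq_iInf_nonbacktrackingMatrix :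
    G.egirth = ⨅ (k : ℕ) (_ : (G.nonbacktrackingMatrix k).trace ≠ 0), ((k + 1 : ℕ) : ℕ∞) := by
  apply le_antisymm
  · refine le_iInf₂ fun k hk => ?_
    obtain ⟨a, c, hc, hlen⟩ := exists_isCycle_of_trace_nonbacktrackingMatrix_ne_zero hk
    exact (egirth_le_length hc).trans (by exact_mod_cast hlen)
  · rw [le_egirth]
    intro a c hc
    obtain ⟨k, hk, htr⟩ := exists_trace_nonbacktrackingMatrix_ne_zero_of_isCycle hc
    rw [← hk]
    exact iInf₂_le k htr

end SimpleGraph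

namespace AlphaSpectra.AlphaCospectral

variable {V W : Type*} [Fintype V] [DecidableEq V] [Fintype W] [DecidableEq W]
  {G : SimpleGraph V} [DecidableRel G.Adj] {H : SimpleGraph W} [DecidableRel H.Adj]

theorem egirth_eq (h : AlphaCospectral G H) (hG : IsRegular G) : G.egirth = H.egirth := by
  obtain ⟨d, hd⟩ := hG
  simp only [SimpleGraph.egirth_eq_iInf_nonbacktrackingMatrix, ← hd.aeval_nonbacktrackingPoly,
    ← (h.isRegularOfDegree hd).aeval_nonbacktrackingPoly, h.trace_aeval_adjMatrix_eq]

end AlphaSpectra.AlphaCospectral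

/-! ### Rooted forests and the matrix-tree theorem -/

namespace SimpleGraph

variable {V : Type*}

/-- A parent function (`none` marks a root) is acyclic if iterating it from any vertex
ends in a root. -/
def AcyclicParent (f : V → Option V) : Prop :=
  ∀ v, ∃ k, (fun o : Option V => o.bind f)^[k] (some v) = none

/-- The height counts the iterations needed to reach `none`. It supports the later inductions and
the triangular ordering. -/
theorem AcyclicParent.exists_height {f : V → Option V} (hf : AcyclicParent f) :
    ∃ h : V → ℕ, ∀ v u, f v = some u → h u < h v := by
  classical
  refine ⟨fun v => Nat.find (hf v), fun v u hvu => ?_⟩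
  have hv := Nat.find_spec (hf v)
  obtain ⟨k, hk⟩ : ∃ k, Nat.find (hf v) = k + 1 := by
    refine Nat.exists_eq_succ_of_ne_zero fun h0 => ?_
    simp [h0] at hv
  rw [hk, Function.iterate_succ_apply, Option.bind_some, hvu] at hv
  exact (Nat.find_min' (hf u) hv).trans_lt (k.lt_succ_self.trans_eq hk.symm)

theorem acyclicParent_of_height {f : V → Option V} (h : V → ℕ)
    (hh : ∀ v u, f v = some u → h u < h v) : AcyclicParent f := by
  intro v
  induction hn : h v using Nat.strong_induction_on generalizing v with
  | _ n ih =>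
    cases hv : f v with
    | none => exact ⟨1, by simp [hv]⟩
    | some u =>
      obtain ⟨k, hk⟩ := ih _ (hn ▸ hh v u hv) u rfl
      exact ⟨k + 1, by rw [Function.iterate_succ_apply, Option.bind_some, hv, hk]⟩

section det

variable [Fintype V] [DecidableEq V]

/-- The row vectors `e_v` (for a root) and `e_v - e_u` (for a child of `u`). -/
def parentRow (v : V) (o : Option V) : V → ℝ :=
  Pi.single v 1 - o.elim 0 fun u => Pi.single u 1

/-- Parents have smaller height, so ordering by height makes the matrix block triangular, with
identity blocks on each level. -/
theorem det_parentRow_of_acyclic {f : V → Option V} (hf : AcyclicParent f) :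
    (of fun v => parentRow v (f v)).det = 1 := by
  obtain ⟨h, hh⟩ := hf.exists_height
  have entry : ∀ v w, parentRow v (f v) w =
      (if w = v then 1 else 0) - if f v = some w then 1 else 0 := by
    intro v w
    cases hv : f v with
    | none => simp [parentRow, Pi.single_apply]
    | some u => simp [parentRow, Pi.single_apply, eq_comm]
  have ht : BlockTriangular (of fun v => parentRow v (f v)) (OrderDual.toDual ∘ h) := by
    intro v w hvw
    simp only [Function.comp_apply, OrderDual.toDual_lt_toDual] at hvw
    have h1 : w ≠ v := by rintro rfl; exact hvw.false
    have h2 : f v ≠ some w := fun e => (hh v w e).not_gt hvw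
    simp [entry, h1, h2]
  rw [ht.det]
  refine Finset.prod_eq_one fun a _ => ?_
  have hone : toSquareBlock (of fun v => parentRow v (f v)) (OrderDual.toDual ∘ h) a = 1 := by
    ext ⟨v, hv⟩ ⟨w, hw⟩
    have h2 : f v ≠ some w := fun e => by
      have := hh v w e
      rw [← hw] at hv
      simp only [Function.comp_apply, OrderDual.toDual_inj] at hv
      omega
    simp [toSquareBlock_def, entry, h2, one_apply, eq_comm]
  rw [hone, det_one]

theorem det_parentRow_of_not_acyclic {f : V → Option V} (hf : ¬ AcyclicParent f) :
    (of fun v => parentRow v (f v)).det = 0 := by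
  classical
  obtain ⟨v₀, hv₀⟩ := not_forall.1 hf
  let P : V → Prop := fun v => ∃ k, (fun o : Option V => o.bind f)^[k] (some v) = none
  have step : ∀ v u, f v = some u → (P v ↔ P u) := by
    intro v u hvu
    constructor
    · rintro ⟨k, hk⟩
      cases k with
      | zero => simp at hk
      | succ k => exact ⟨k, by rwa [Function.iterate_succ_apply, Option.bind_some, hvu] at hk⟩
    · rintro ⟨k, hk⟩
      exact ⟨k + 1, by rw [Function.iterate_succ_apply, Option.bind_some, hvu, hk]⟩
  -- The indicator of the vertices that never reach a root is constant from child to parent and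
  -- vanishes at roots, so it is a kernel vector.
  refine exists_mulVec_eq_zero_iff.1 ⟨fun v => if P v then 0 else 1, ?_, ?_⟩
  · intro h
    have := congrFun h v₀
    simp only [P, if_neg hv₀] at this
    simp at this
  · ext v
    simp only [mulVec, of_apply, parentRow, sub_dotProduct, single_one_dotProduct, Pi.zero_apply]
    cases hv : f v with
    | none =>
      have : P v := ⟨1, by simp [hv]⟩
      simp [this]
    | some u => simp [step v u hv]

end det

section forest

variable [Fintype V] [DecidableEq V] (G : SimpleGraph V) [DecidableRel G.Adj]

/-- The parent functions of the rooted spanning forests of `G`. -/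
noncomputable def forests : Finset (V → Option V) :=
  open Classical in {f | (∀ v u, f v = some u → G.Adj v u) ∧ AcyclicParent f}

/-- The generating polynomial of the rooted spanning forests, by their number of roots. -/
noncomputable def forestPoly : ℝ[X] :=
  ∑ f ∈ G.forests, X ^ (Finset.univ.filter fun v => f v = none).card

/-- Row `v` of `t + L` is `t e_v` plus the sum of `e_v - e_u` over the neighbours `u`. Multilinear
expansion chooses "root" or a parent at each vertex, and only acyclic choices have nonzero
determinant. -/
theorem eval_forestPoly (t : ℝ) : G.forestPoly.eval t = (scalar V t + G.lapMatrix ℝ).det := by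
  classical
  have hrow : (scalar V t + G.lapMatrix ℝ) = of fun v => ∑ o : Option V,
      (o.elim t fun u => if G.Adj v u then 1 else 0) • parentRow v o := by
    ext v w
    simp only [of_apply, Fintype.sum_option, Option.elim_none, Option.elim_some, parentRow,
      sub_zero, Pi.add_apply, Pi.smul_apply, Finset.sum_apply, Pi.sub_apply, Pi.single_apply,
      smul_eq_mul, ite_mul, one_mul, zero_mul, mul_sub, Finset.sum_sub_distrib, Matrix.add_apply,
      scalar_apply, lapMatrix, degMatrix, Matrix.sub_apply, diagonal_apply, adjMatrix_apply,
      degree_eq_sum_if_adj]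
    have hsum : ∑ u, (if G.Adj v u then if w = u then (1 : ℝ) else 0 else 0) =
        if G.Adj v w then 1 else 0 := by
      rw [Finset.sum_eq_single w] <;> simp +contextual [eq_comm]
    rw [hsum]
    by_cases h : v = w
    · subst h
      simp
    · simp [h, Ne.symm h]
  have hexp : (scalar V t + G.lapMatrix ℝ).det = ∑ f : V → Option V,
      (∏ v, (f v).elim t fun u => if G.Adj v u then 1 else 0) *
        (of fun v => parentRow v (f v)).det := by
    rw [hrow]
    have := (detRowAlternating (R := ℝ) (n := V)).toMultilinearMap.map_sum
      (g := fun v (o : Option V) => (o.elim t fun u => if G.Adj v u then 1 else 0) • parentRow v o)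
    refine this.trans (Finset.sum_congr rfl fun f _ => ?_)
    rw [MultilinearMap.map_smul_univ, smul_eq_mul]
    rfl
  rw [hexp, forestPoly, eval_finsetSum, forests, Finset.sum_filter]
  refine Finset.sum_congr rfl fun f _ => ?_
  by_cases hadj : ∀ v u, f v = some u → G.Adj v u
  · have hprod : (∏ v, (f v).elim t fun u => if G.Adj v u then 1 else 0) =
        t ^ (Finset.univ.filter fun v => f v = none).card := by
      rw [← Finset.prod_const, Finset.prod_filter]
      refine Finset.prod_congr rfl fun v _ => ?_
      cases hv : f v with
      | none => simp
      | some u => simp [hadj v u hv]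
    by_cases hac : AcyclicParent f
    · rw [if_pos ⟨hadj, hac⟩, hprod, det_parentRow_of_acyclic hac]
      simp
    · rw [if_neg fun h => hac h.2, det_parentRow_of_not_acyclic hac, mul_zero]
  · rw [if_neg fun h => hadj h.1]
    push Not at hadj
    obtain ⟨v, u, hvu, hnadj⟩ := hadj
    rw [Finset.prod_eq_zero (Finset.mem_univ v) (by simp [hvu, hnadj]), zero_mul]

end forest

/-- The graph whose edges join each vertex to its parent. -/
def parentGraph (f : V → Option V) : SimpleGraph V := fromRel fun v u => f v = some u

theorem AcyclicParent.parentGraph_adj {f : V → Option V} (hf : AcyclicParent f) {u v : V} :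
    (parentGraph f).Adj u v ↔ f u = some v ∨ f v = some u := by
  obtain ⟨h, hh⟩ := hf.exists_height
  rw [parentGraph, fromRel_adj, and_iff_right_iff_imp]
  rintro (e | e) rfl <;> exact (hh _ _ e).false

theorem AcyclicParent.parentGraph_connected {f : V → Option V} (hf : AcyclicParent f) {r : V}
    (hr : ∀ v, f v = none ↔ v = r) : (parentGraph f).Connected := by
  obtain ⟨h, hh⟩ := hf.exists_height
  have key : ∀ v, (parentGraph f).Reachable v r := by
    intro v
    induction hn : h v using Nat.strong_induction_on generalizing v with
    | _ n ih =>
      cases hv : f v with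
      | none => rw [(hr v).1 hv]
      | some u =>
        exact (Adj.reachable (hf.parentGraph_adj.2 (Or.inl hv))).trans
          (ih _ (hn ▸ hh v u hv) u rfl)
  have : Nonempty V := ⟨r⟩
  exact ⟨fun u v => (key u).trans (key v).symm⟩

theorem AcyclicParent.parentGraph_isTree [Fintype V] {f : V → Option V} (hf : AcyclicParent f)
    {r : V} (hr : ∀ v, f v = none ↔ v = r) : (parentGraph f).IsTree := by
  classical
  have hc := hf.parentGraph_connected hr
  refine isTree_iff_connected_and_card.2 ⟨hc, le_antisymm ?_ hc.card_vert_le_card_edgeSet_add_one⟩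
  -- Each edge comes from a non-root vertex, giving at most `n - 1` edges; the default in `getD` is
  -- never reached.
  have hsub : (parentGraph f).edgeSet ⊆
      ((Finset.univ.erase r).image fun v => s(v, (f v).getD v) : Finset (Sym2 V)) := by
    intro e
    induction e with
    | _ u v =>
      rw [mem_edgeSet, hf.parentGraph_adj]
      rintro (h | h)
      · have : u ≠ r := fun e => by simp [(hr u).2 e] at h
        exact Finset.mem_coe.2 (Finset.mem_image.2 ⟨u, by simp [this], by simp [h]⟩)
      · have : v ≠ r := fun e => by simp [(hr v).2 e] at h
        exact Finset.mem_coe.2 (Finset.mem_image.2 ⟨v, by simp [this], by simp [h, Sym2.eq_swap]⟩)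
  have h1 := (Set.ncard_le_ncard hsub (Finset.finite_toSet _)).trans_eq (Set.ncard_coe_finset _)
  have h2 := h1.trans Finset.card_image_le
  rw [Finset.card_erase_of_mem (Finset.mem_univ r), Finset.card_univ] at h2
  have : 0 < Fintype.card V := Fintype.card_pos_iff.2 ⟨r⟩
  rw [Nat.card_coe_set_eq, Nat.card_eq_fintype_card]
  omega

/-- A parent function is determined by its root and its graph. -/
theorem AcyclicParent.eq_of_parentGraph_eq {f g : V → Option V} (hf : AcyclicParent f)
    (hg : AcyclicParent g) {r : V} (hfr : ∀ v, f v = none ↔ v = r) (hgr : ∀ v, g v = none ↔ v = r)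
    (h : parentGraph f = parentGraph g) : f = g := by
  obtain ⟨ht, hht⟩ := hf.exists_height
  funext v
  induction hn : ht v using Nat.strong_induction_on generalizing v with
  | _ n ih =>
    cases hv : f v with
    | none => exact ((hgr v).2 ((hfr v).1 hv)).symm
    | some u =>
      have hadj : (parentGraph g).Adj v u := h ▸ hf.parentGraph_adj.2 (Or.inl hv)
      rcases hg.parentGraph_adj.1 hadj with e | e
      · exact e.symm
      -- If `v` were the parent of `u` under `g`, then by induction also under `f`, while `u` is the
      -- parent of `v` under `f`: the heights contradict this.
      · have h1 := hht v u hv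
        have h2 := ih _ (hn ▸ h1) u rfl
        rw [e] at h2
        have := hht u v h2
        omega

/-- Every tree is the graph of a parent function with a given root. -/
theorem IsTree.exists_parent {T : SimpleGraph V} (hT : T.IsTree) (r : V) :
    ∃ f : V → Option V, AcyclicParent f ∧ (∀ v, f v = none ↔ v = r) ∧ parentGraph f = T := by
  classical
  have hstep : ∀ v, v ≠ r → ∃ u, T.Adj v u ∧ T.dist u r < T.dist v r := by
    intro v hv
    obtain ⟨p, hp⟩ := hT.connected.exists_walk_length_eq_dist v r
    cases p with
    | nil => exact absurd rfl hv
    | @cons _ u _ h p =>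
      refine ⟨u, h, (dist_le p).trans_lt ?_⟩
      rw [← hp, Walk.length_cons]
      omega
  choose! g hg hlt using hstep
  let f : V → Option V := fun v => if v = r then none else some (g v)
  have hf : ∀ v u, f v = some u ↔ v ≠ r ∧ g v = u := by intro v u; simp [f]
  have hr : ∀ v, f v = none ↔ v = r := by intro v; simp [f]
  have hac : AcyclicParent f := acyclicParent_of_height (fun v => T.dist v r) fun v u hvu => by
    obtain ⟨hv, rfl⟩ := (hf v u).1 hvu
    exact hlt v hv
  refine ⟨f, hac, hr, ?_⟩
  have hle : parentGraph f ≤ T := by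
    intro u v huv
    rcases hac.parentGraph_adj.1 huv with e | e
    · obtain ⟨hu, rfl⟩ := (hf _ _).1 e
      exact hg u hu
    · obtain ⟨hv, rfl⟩ := (hf _ _).1 e
      exact (hg v hv).symm
  exact le_antisymm hle
    ((isTree_iff_minimal_connected.1 hT).2 (hac.parentGraph_connected hr) hle)

/-- The **matrix-tree theorem**, in the form of a coefficient of the Laplacian polynomial. -/
theorem coeff_one_forestPoly [Fintype V] [DecidableEq V] (G : SimpleGraph V) [DecidableRel G.Adj] :
    G.forestPoly.coeff 1 = Fintype.card V * AlphaSpectra.numSpanningTrees G := by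
  classical
  let S : Finset (V → Option V) :=
    G.forests.filter fun f => (Finset.univ.filter fun v => f v = none).card = 1
  have hS : ∀ f, f ∈ S ↔ (∀ v u, f v = some u → G.Adj v u) ∧ AcyclicParent f ∧
      ∃ r, ∀ v, f v = none ↔ v = r := by
    intro f
    simp only [S, forests, Finset.mem_filter, Finset.mem_univ, true_and, Finset.card_eq_one,
      Finset.ext_iff, Finset.mem_singleton, and_assoc]
  have h1 : G.forestPoly.coeff 1 = S.card := by
    simp only [forestPoly, finsetSum_coeff, coeff_X_pow, S, Finset.card_filter, eq_comm (a := 1)]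
    push_cast
    rfl
  have root : ∀ f : S, ∃ r, ∀ v, f.1 v = none ↔ v = r := fun f => ((hS _).1 f.2).2.2
  choose root hroot using root
  -- A forest with one root is a spanning tree with a chosen root, whence the factor `Fintype.card
  -- V`.
  let Φ : S → V × {T : SimpleGraph V // T ≤ G ∧ T.IsTree} := fun f =>
    (root f, ⟨parentGraph f.1, by
      have hf := (hS _).1 f.2
      refine ⟨?_, hf.2.1.parentGraph_isTree (hroot f)⟩
      intro u v huv
      rcases hf.2.1.parentGraph_adj.1 huv with e | e
      · exact hf.1 _ _ e
      · exact (hf.1 _ _ e).symm⟩)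
  have hΦ : Function.Bijective Φ := by
    constructor
    · intro f g hfg
      simp only [Φ, Prod.mk.injEq, Subtype.mk.injEq] at hfg
      exact Subtype.ext (((hS _).1 f.2).2.1.eq_of_parentGraph_eq ((hS _).1 g.2).2.1 (hroot f)
        (hfg.1 ▸ hroot g) hfg.2)
    · rintro ⟨r, T, hTG, hT⟩
      obtain ⟨f, hac, hr, rfl⟩ := hT.exists_parent r
      have hf : f ∈ S := (hS f).2
        ⟨fun v u e => hTG (hac.parentGraph_adj.2 (Or.inl e)), hac, r, hr⟩
      refine ⟨⟨f, hf⟩, ?_⟩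
      have : root ⟨f, hf⟩ = r := ((hr _).1 ((hroot ⟨f, hf⟩ _).2 rfl))
      simp [Φ, this]
  have h2 := Nat.card_congr (Equiv.ofBijective Φ hΦ)
  rw [Nat.card_prod, Nat.card_eq_fintype_card, Nat.card_eq_fintype_card, Fintype.card_coe] at h2
  rw [h1, h2, AlphaSpectra.numSpanningTrees]
  push_cast
  rfl

end SimpleGraph

/-! ### Bipartite graphs: components and spanning trees -/

namespace AlphaSpectra

variable {V W : Type*} [Fintype V] [DecidableEq V] [Fintype W] [DecidableEq W]

/-- For a bipartite graph, a signature matrix conjugates the signless Laplacian `2 A_{1/2}`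
into the Laplacian. -/
theorem eval_charpoly_lapMatrix_of_isBipartite {G : SimpleGraph V} [DecidableRel G.Adj]
    (hG : G.IsBipartite) (t : ℝ) :
    (G.lapMatrix ℝ).charpoly.eval t =
      2 ^ Fintype.card V * (alphaMatrix G (1 / 2)).charpoly.eval (t / 2) := by
  obtain ⟨c⟩ := hG
  -- Conjugation by these signs fixes the diagonal and negates the entries at edges, which join
  -- opposite colours.
  let s : V → ℝ := fun v => if c v = 0 then 1 else -1
  have hs : ∀ v, s v * s v = 1 := fun v => by simp only [s]; split_ifs <;> norm_num
  have hadj : ∀ u v, G.Adj u v → s u * s v = -1 := fun u v huv => by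
    have := c.valid huv
    have h : (c u = 0 ∧ c v ≠ 0) ∨ (c u ≠ 0 ∧ c v = 0) := by omega
    rcases h with h | h <;> simp [s, h]
  have hD : diagonal s * diagonal s = 1 := by
    rw [diagonal_mul_diagonal, ← diagonal_one]
    exact congrArg diagonal (funext hs)
  have hdet : (diagonal s).det * (diagonal s).det = 1 := by rw [← det_mul, hD, det_one]
  have key : scalar V t - G.lapMatrix ℝ =
      diagonal s * ((2 : ℝ) • (scalar V (t / 2) - alphaMatrix G (1 / 2))) * diagonal s := by
    ext u v
    rw [mul_diagonal, diagonal_mul]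
    simp only [alphaMatrix, SimpleGraph.lapMatrix, SimpleGraph.degMatrix, Matrix.sub_apply,
      Matrix.add_apply, Matrix.smul_apply, smul_eq_mul, scalar_apply, diagonal_apply,
      SimpleGraph.adjMatrix_apply]
    by_cases huv : u = v
    · subst huv
      simp only [if_true, G.irrefl, if_false]
      linear_combination (-(t - G.degree u)) * hs u
    · by_cases h : G.Adj u v
      · simp only [if_neg huv, if_pos h]
        linear_combination hadj u v h
      · simp [huv, h]
  rw [eval_charpoly, eval_charpoly, key, det_mul, det_mul, det_smul]
  linear_combination (2 ^ Fintype.card V * (scalar V (t / 2) - alphaMatrix G (1 / 2)).det) * hdet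

theorem forestPoly_eq_charpoly_comp (G : SimpleGraph V) [DecidableRel G.Adj] :
    G.forestPoly = (-1) ^ Fintype.card V * (G.lapMatrix ℝ).charpoly.comp (-X) := by
  refine Polynomial.funext fun t => ?_
  have h : scalar V t + G.lapMatrix ℝ = -(scalar V (-t) - G.lapMatrix ℝ) := by
    rw [map_neg]
    abel
  rw [SimpleGraph.eval_forestPoly, h, det_neg]
  simp [eval_charpoly]

namespace AlphaCospectral

variable {G : SimpleGraph V} [DecidableRel G.Adj] {H : SimpleGraph W} [DecidableRel H.Adj]

theorem charpoly_lapMatrix_eq (h : AlphaCospectral G H) (hG : G.IsBipartite) :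
    (G.lapMatrix ℝ).charpoly = (H.lapMatrix ℝ).charpoly := by
  have h2 := (isHermitian_alphaMatrix G (1 / 2)).charpoly_eq_of_roots_eq
    (isHermitian_alphaMatrix H (1 / 2)) (h (1 / 2) (by norm_num))
  refine Polynomial.funext fun t => ?_
  rw [eval_charpoly_lapMatrix_of_isBipartite hG,
    eval_charpoly_lapMatrix_of_isBipartite (h.isBipartite_iff.1 hG), h2, h.card_eq]

theorem card_connectedComponent_eq (h : AlphaCospectral G H) (hG : G.IsBipartite) :
    Nat.card G.ConnectedComponent = Nat.card H.ConnectedComponent := by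
  classical
  rw [Nat.card_eq_fintype_card, Nat.card_eq_fintype_card,
    G.card_connectedComponent_eq_finrank_ker_toLin'_lapMatrix,
    H.card_connectedComponent_eq_finrank_ker_toLin'_lapMatrix,
    (G.isHermitian_lapMatrix ℝ).finrank_ker_eq_sub, (H.isHermitian_lapMatrix ℝ).finrank_ker_eq_sub,
    h.charpoly_lapMatrix_eq hG]

theorem numSpanningTrees_eq (h : AlphaCospectral G H) (hG : G.IsBipartite) :
    numSpanningTrees G = numSpanningTrees H := by
  have hcoeff : G.forestPoly.coeff 1 = H.forestPoly.coeff 1 := by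
    rw [forestPoly_eq_charpoly_comp, forestPoly_eq_charpoly_comp, h.charpoly_lapMatrix_eq hG,
      h.card_eq]
  rw [G.coeff_one_forestPoly, H.coeff_one_forestPoly, h.card_eq] at hcoeff
  -- Cancelling the number of vertices requires it to be nonzero; an empty vertex set carries no
  -- tree.
  rcases isEmpty_or_nonempty W with hW | hW
  · have hV : IsEmpty V := Fintype.card_eq_zero_iff.1 (h.card_eq.trans Fintype.card_eq_zero)
    have hG0 : IsEmpty {T : SimpleGraph V // T ≤ G ∧ T.IsTree} :=
      ⟨fun T => T.2.2.connected.nonempty.elim hV.false⟩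
    have hH0 : IsEmpty {T : SimpleGraph W // T ≤ H ∧ T.IsTree} :=
      ⟨fun T => T.2.2.connected.nonempty.elim hW.false⟩
    rw [numSpanningTrees, numSpanningTrees, Nat.card_of_isEmpty, Nat.card_of_isEmpty]
  · have hne : (Fintype.card W : ℝ) ≠ 0 := Nat.cast_ne_zero.2 Fintype.card_ne_zero
    exact_mod_cast mul_left_cancel₀ hne hcoeff

end AlphaCospectral

end AlphaSpectra

end

theorem theorem4p1 {V W : Type*} [Fintype V] [DecidableEq V] [Fintype W] [DecidableEq W]
    (G : SimpleGraph V) [DecidableRel G.Adj] (H : SimpleGraph W) [DecidableRel H.Adj]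
    (hGH : AlphaSpectra.AlphaCospectral G H) :
    -- number of vertices
    Fintype.card V = Fintype.card W ∧
    -- number of edges
    G.edgeFinset.card = H.edgeFinset.card ∧
    -- regularity
    (AlphaSpectra.IsRegular G ↔ AlphaSpectra.IsRegular H) ∧
    -- regularity with any fixed girth (the girth of a forest is infinite)
    (∀ g : ℕ∞, (AlphaSpectra.IsRegular G ∧ G.egirth = g) ↔
      (AlphaSpectra.IsRegular H ∧ H.egirth = g)) ∧
    -- bipartiteness
    (G.IsBipartite ↔ H.IsBipartite) ∧
    -- number of closed walks of any fixed length, and number of triangles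
    (∀ k : ℕ, AlphaSpectra.numClosedWalks G k = AlphaSpectra.numClosedWalks H k) ∧
    (G.cliqueFinset 3).card = (H.cliqueFinset 3).card ∧
    -- sum of the squares of the degrees
    (∑ v, G.degree v ^ 2 = ∑ w, H.degree w ^ 2) ∧
    -- sum of the cubes of the degrees
    (∑ v, G.degree v ^ 3 = ∑ w, H.degree w ^ 3) ∧
    -- for bipartite graphs: number of components and number of spanning trees
    (G.IsBipartite →
      Nat.card G.ConnectedComponent = Nat.card H.ConnectedComponent ∧
      AlphaSpectra.numSpanningTrees G = AlphaSpectra.numSpanningTrees H) := by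
  refine ⟨hGH.card_eq, hGH.card_edgeFinset_eq, hGH.isRegular_iff, fun g => ?_,
    hGH.isBipartite_iff, hGH.numClosedWalks_eq, hGH.card_cliqueFinset_three_eq,
    hGH.sum_degree_eq (· ^ 2), hGH.sum_degree_eq (· ^ 3),
    fun hG => ⟨hGH.card_connectedComponent_eq hG, hGH.numSpanningTrees_eq hG⟩⟩
  constructor
  · rintro ⟨hG, rfl⟩
    exact ⟨hGH.isRegular_iff.1 hG, (hGH.egirth_eq hG).symm⟩
  · rintro ⟨hH, rfl⟩
    exact ⟨hGH.isRegular_iff.2 hH, hGH.egirth_eq (hGH.isRegular_iff.2 hH)⟩
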